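/- Let $\mathcal{S}(\mathbb{R})$ be the Schwartz space of (complex-valued) rapidly decreasing smooth functions on $\mathbb{R}$ and $\mathcal{S}'(\mathbb{R})$ its dual, the space of tempered distributions. **Theorem (Denjoy–Carleman uniqueness).** Let $\beta\ge 1$ be real and let $\varphi\in\mathcal{S}(\mathbb{R})$ satisfy $\varphi(x)>0$ for all $x\in\mathbb{R}$. Assume that $\varphi$ satisfies the exponential-type decay condition of order $\beta$: there exist $A>0$ and, for each integer $m\ge 0$, a constant $C_m>0$ such that $$\sup_{x\in\mathbb{R}}\,(1+|x|)^k\,|\varphi^{(m)}(x)|\;\le\; C_m\,A^k\,(k!)^{1/\beta}\qquad\text{for all integers } k,m\ge 0.$$ If $T_1,T_2\in\mathcal{S}'(\mathbb{R})$ satisfy $$\langle T_1,x^n\varphi\rangle=\langle T_2,x^n\varphi\rangle\qquad\text{for all integers } n\ge 0,$$ then $T_1=T_2$. -/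

import Mathlib

open scoped SchwartzMap

namespace WeakMoment

/-- The kernel times a monomial, `x ↦ x ^ n * φ x`, as a Schwartz function. -/
noncomputable def monomialMul (n : ℕ) (φ : 𝓢(ℝ, ℂ)) : 𝓢(ℝ, ℂ) :=
  SchwartzMap.smulLeftCLM ℂ (fun x : ℝ => (x : ℂ) ^ n) φ

/-- `monomialMul n φ` really is the pointwise product (monomials have temperate growth). -/
theorem monomialMul_apply (n : ℕ) (φ : 𝓢(ℝ, ℂ)) (x : ℝ) :
    monomialMul n φ x = (x : ℂ) ^ n * φ x := by
  have h : (fun x : ℝ => (x : ℂ) ^ n).HasTemperateGrowth := by fun_prop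
  simp [monomialMul, SchwartzMap.smulLeftCLM_apply_apply h]

/-- The `n`-th weak moment `⟨T, x ^ n φ⟩` of the distribution-kernel pair `(T, φ)`. -/
noncomputable def weakMoment (T : 𝓢'(ℝ, ℂ)) (φ : 𝓢(ℝ, ℂ)) (n : ℕ) : ℂ :=
  T (monomialMul n φ)

/-- The exponential-type decay condition of order `β` (meant for `1 ≤ β`): there are `A > 0` and
constants `C m > 0` with `sup_x (1 + |x|) ^ k |φ^(m) (x)| ≤ C m * A ^ k * (k !) ^ (1 / β)`
for all `k` and `m`. -/
def ExpTypeDecay (β : ℝ) (φ : 𝓢(ℝ, ℂ)) : Prop :=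
  ∃ A : ℝ, 0 < A ∧ ∃ C : ℕ → ℝ, (∀ m, 0 < C m) ∧
    ∀ (k m : ℕ) (x : ℝ),
      (1 + |x|) ^ k * ‖iteratedDeriv m φ x‖ ≤ C m * A ^ k * (k.factorial : ℝ) ^ (1 / β)

end WeakMoment

/-! Let `T` be the difference of the two distributions. Since β ≥ 1, the decay condition makes `φ`
and all its derivatives O(exp(-c|x|)) for some c > 0 (`ExpTypeDecay.exists_hasExpDecay`). Hence for
|h| < c the Taylor series of exp(ihx), multiplied by exp(iξx) x^n φ, converges in Schwartz space,
and vanishing of all moments passes from frequency ξ to ξ + h (`map_imExp_add_eq_zero`). Finitely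
many short steps from 0 give T(exp(iξx) φ) = 0 for every real ξ. Fourier inversion then gives T(gφ)
= 0 for every Schwartz `g` (`map_smulLeftCLM_eq_zero`). As `φ` has no zeros, every cutoff of a
Schwartz `f` has the form gφ, and the cutoffs converge to `f`, so T f = 0. Limits and integrals are
handled in a Banach space: `T` factors through finitely many maps x^k f^(m) into bounded continuous
functions (`exists_eq_comp_jet`). -/

namespace WeakMoment

open Filter Topology BoundedContinuousFunction MeasureTheory FourierTransform Real

/-! ### Jets and factorization of tempered functionals. -/

/-- Multiplication by the coordinate. -/
noncomputable def coordCLM : 𝓢(ℝ, ℂ) →L[ℂ] 𝓢(ℝ, ℂ) :=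
  SchwartzMap.smulLeftCLM ℂ (fun x : ℝ => (x : ℂ))

theorem coordCLM_apply (f : 𝓢(ℝ, ℂ)) (x : ℝ) : coordCLM f x = (x : ℂ) * f x := by
  have h : (fun x : ℝ => (x : ℂ)).HasTemperateGrowth := by fun_prop
  simp [coordCLM, SchwartzMap.smulLeftCLM_apply_apply h]

/-- `f ↦ x ^ k * f^(m)` as an operator into bounded continuous functions. -/
noncomputable def jet (k m : ℕ) : 𝓢(ℝ, ℂ) →L[ℂ] (ℝ →ᵇ ℂ) :=
  (SchwartzMap.toBoundedContinuousFunctionCLM ℂ ℝ ℂ).comp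
    ((coordCLM ^ k).comp (SchwartzMap.derivCLM ℂ ℂ ^ m))

/-- Composing on the right lets a property quantified over all `f` be applied to xf or f', so only
the sup norm needs an analytic estimate. -/
theorem jet_induction {P : (𝓢(ℝ, ℂ) →L[ℂ] (ℝ →ᵇ ℂ)) → Prop}
    (base : P (SchwartzMap.toBoundedContinuousFunctionCLM ℂ ℝ ℂ))
    (coord : ∀ L, P L → P (L.comp coordCLM))
    (deriv : ∀ L, P L → P (L.comp (SchwartzMap.derivCLM ℂ ℂ))) (k m : ℕ) : P (jet k m) := by
  induction m with
  | zero =>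
    induction k with
    | zero => exact base
    | succ k ih =>
      have : jet (k + 1) 0 = (jet k 0).comp coordCLM := by
        ext f x; simp [jet, pow_succ]
      rw [this]; exact coord _ ih
  | succ m ih =>
    have : jet k (m + 1) = (jet k m).comp (SchwartzMap.derivCLM ℂ ℂ) := by
      ext f x; simp [jet, pow_succ]
    rw [this]; exact deriv _ ih

theorem jet_apply (k m : ℕ) (f : 𝓢(ℝ, ℂ)) (x : ℝ) :
    jet k m f x = (x : ℂ) ^ k * iteratedDeriv m f x := by
  have hX : ∀ (k : ℕ) (g : 𝓢(ℝ, ℂ)), (coordCLM ^ k) g x = (x : ℂ) ^ k * g x := by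
    intro k
    induction k with
    | zero => intro g; simp
    | succ k ih =>
      intro g
      rw [pow_succ, mul_apply_eq_comp, ih, coordCLM_apply]; ring
  have hD : ∀ (m : ℕ) (g : 𝓢(ℝ, ℂ)),
      ((SchwartzMap.derivCLM ℂ ℂ ^ m) g : ℝ → ℂ) = iteratedDeriv m g := by
    intro m
    induction m with
    | zero => intro g; simp
    | succ m ih =>
      intro g
      rw [pow_succ, mul_apply_eq_comp, ih, iteratedDeriv_succ']
      congr 1
  simp only [jet, ContinuousLinearMap.comp_apply,
    SchwartzMap.toBoundedContinuousFunctionCLM_apply, hX, hD]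

theorem seminorm_le_norm_jet (k m : ℕ) (f : 𝓢(ℝ, ℂ)) :
    SchwartzMap.seminorm ℂ k m f ≤ ‖jet k m f‖ := by
  refine SchwartzMap.seminorm_le_bound' ℂ k m f (norm_nonneg _) fun x => ?_
  have := (jet k m f).norm_coe_le_norm x
  simpa [jet_apply] using this

/-- A tempered functional factors through finitely many jets. -/
theorem exists_eq_comp_jet (T : 𝓢(ℝ, ℂ) →L[ℂ] ℂ) :
    ∃ (s : Finset (ℕ × ℕ)) (L : (s → (ℝ →ᵇ ℂ)) →L[ℂ] ℂ),
      ∀ f, T f = L (fun i => jet i.1.1 i.1.2 f) := by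
  have hc : Continuous (T.toLinearMap.toSeminorm) := by
    exact continuous_norm.comp T.continuous
  obtain ⟨s, C, -, hC⟩ := Seminorm.bound_of_continuous
    (schwartz_withSeminorms ℂ ℝ ℂ) T.toLinearMap.toSeminorm hc
  let J : 𝓢(ℝ, ℂ) →ₗ[ℂ] (s → (ℝ →ᵇ ℂ)) :=
    LinearMap.pi fun i : s => (jet i.1.1 i.1.2).toLinearMap
  have hb : ∃ C, ∀ f, ‖T.toLinearMap f‖ ≤ C * ‖J f‖ := by
    refine ⟨C, fun f => ?_⟩
    refine (hC f).trans ?_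
    simp only [_root_.smul_apply, NNReal.smul_def, smul_eq_mul]
    refine mul_le_mul_of_nonneg_left ?_ C.2
    refine Seminorm.finset_sup_apply_le (norm_nonneg _) fun i hi => ?_
    exact (seminorm_le_norm_jet i.1 i.2 f).trans (norm_le_pi_norm (J f) ⟨i, hi⟩)
  -- Hahn–Banach: by `hb`, `T` descends to a bounded functional on the range of `J`, which then
  -- extends.
  obtain ⟨L, hL, -⟩ := exists_extension_norm_eq _ (T.toLinearMap.compLeftInverse J)
  refine ⟨s, L, fun f => ?_⟩
  have h1 := hL ⟨J f, LinearMap.mem_range_self _ _⟩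
  rw [LinearMap.compLeftInverse_apply_of_bdd _ _ hb f (J f) rfl] at h1
  exact h1.symm

theorem tendsto_of_tendsto_jet {ι : Type*} {l : Filter ι} {F : ι → 𝓢(ℝ, ℂ)} {f : 𝓢(ℝ, ℂ)}
    (h : ∀ k m, Tendsto (fun i => jet k m (F i)) l (𝓝 (jet k m f)))
    (T : 𝓢(ℝ, ℂ) →L[ℂ] ℂ) : Tendsto (fun i => T (F i)) l (𝓝 (T f)) := by
  obtain ⟨s, L, hL⟩ := exists_eq_comp_jet T
  simp only [hL]
  exact (L.continuous.tendsto _).comp (tendsto_pi_nhds.2 fun i => h _ _)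

/-! ### Multipliers and imaginary exponentials. -/

/-- The product rule for Schwartz functions and temperate multipliers. -/
theorem derivCLM_smulLeftCLM {g g' : ℝ → ℂ} (hg : g.HasTemperateGrowth)
    (hg' : g'.HasTemperateGrowth) (h : ∀ x, HasDerivAt g (g' x) x) (f : 𝓢(ℝ, ℂ)) :
    SchwartzMap.derivCLM ℂ ℂ (SchwartzMap.smulLeftCLM ℂ g f) =
      SchwartzMap.smulLeftCLM ℂ g' f +
        SchwartzMap.smulLeftCLM ℂ g (SchwartzMap.derivCLM ℂ ℂ f) := by
  ext x
  have h1 : (SchwartzMap.smulLeftCLM ℂ g f : ℝ → ℂ) = fun x => g x * f x := by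
    ext x; simp [SchwartzMap.smulLeftCLM_apply_apply hg]
  rw [SchwartzMap.derivCLM_apply, h1, ((h x).fun_mul (f.hasDerivAt x)).deriv]
  simp [SchwartzMap.smulLeftCLM_apply_apply hg, SchwartzMap.smulLeftCLM_apply_apply hg']

theorem coordCLM_smulLeftCLM {g : ℝ → ℂ} (hg : g.HasTemperateGrowth) (f : 𝓢(ℝ, ℂ)) :
    coordCLM (SchwartzMap.smulLeftCLM ℂ g f) = SchwartzMap.smulLeftCLM ℂ g (coordCLM f) := by
  ext x
  simp [coordCLM_apply, SchwartzMap.smulLeftCLM_apply_apply hg]; ring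

/-- The imaginary exponential `x ↦ exp (i a x)`. -/
noncomputable def imExp (a : ℝ) (x : ℝ) : ℂ := Complex.exp (Complex.I * a * x)

theorem norm_imExp (a x : ℝ) : ‖imExp a x‖ = 1 := by
  rw [imExp, mul_assoc, mul_comm, ← Complex.ofReal_mul, Complex.norm_exp_ofReal_mul_I]

theorem hasDerivAt_imExp (a x : ℝ) : HasDerivAt (imExp a) (Complex.I * a * imExp a x) x := by
  have h : HasDerivAt (fun x : ℝ => Complex.I * a * (x : ℂ)) (Complex.I * a * 1) x :=
    (Complex.ofRealCLM.hasDerivAt (x := x)).const_mul _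
  have := h.cexp
  rw [mul_one, mul_comm (Complex.exp _)] at this
  exact this

theorem iteratedDeriv_imExp (a : ℝ) (n : ℕ) :
    iteratedDeriv n (imExp a) = fun x => (Complex.I * a) ^ n * imExp a x := by
  induction n with
  | zero => simp
  | succ n ih =>
    ext x
    rw [iteratedDeriv_succ, ih, ((hasDerivAt_imExp a x).const_mul _).deriv]; ring

@[fun_prop]
theorem hasTemperateGrowth_imExp (a : ℝ) : (imExp a).HasTemperateGrowth := by
  refine ⟨?_, fun n => ⟨0, |a| ^ n, fun x => ?_⟩⟩
  · exact (contDiff_const.mul Complex.ofRealCLM.contDiff).cexp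
  · rw [norm_iteratedFDeriv_eq_norm_iteratedDeriv, iteratedDeriv_imExp]
    simp [norm_imExp]

theorem imExp_add (a b x : ℝ) : imExp (a + b) x = imExp a x * imExp b x := by
  rw [imExp, imExp, imExp, ← Complex.exp_add]; push_cast; ring_nf

theorem norm_imExp_sub_le (a b x : ℝ) : ‖imExp a x - imExp b x‖ ≤ |a - b| * |x| := by
  have h : imExp a x - imExp b x = imExp b x * (imExp (a - b) x - 1) := by
    rw [mul_sub, ← imExp_add]; simp
  rw [h, norm_mul, norm_imExp, one_mul, imExp, mul_assoc, ← Complex.ofReal_mul, ← abs_mul]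
  exact Real.norm_exp_I_mul_ofReal_sub_one_le

/-- The map is Lipschitz: the factor |x| in `norm_imExp_sub_le` is absorbed by the decay of `f`. -/
theorem continuous_toBoundedContinuousFunction_imExp (f : 𝓢(ℝ, ℂ)) :
    Continuous fun a : ℝ => SchwartzMap.toBoundedContinuousFunctionCLM ℂ ℝ ℂ
      (SchwartzMap.smulLeftCLM ℂ (imExp a) f) := by
  set K : ℝ := SchwartzMap.seminorm ℂ 1 0 f
  have hK : 0 ≤ K := apply_nonneg _ _
  refine (LipschitzWith.of_dist_le_mul (K := ⟨K, hK⟩) fun a b => ?_).continuous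
  rw [BoundedContinuousFunction.dist_le (by positivity)]
  intro x
  have h1 := SchwartzMap.norm_pow_mul_le_seminorm ℂ f 1 x
  rw [pow_one, Real.norm_eq_abs] at h1
  simp only [SchwartzMap.toBoundedContinuousFunctionCLM_apply,
    SchwartzMap.smulLeftCLM_apply_apply (hasTemperateGrowth_imExp _), dist_eq_norm,
    smul_eq_mul, ← sub_mul, norm_mul, Real.norm_eq_abs]
  calc _ ≤ |a - b| * |x| * ‖f x‖ := by gcongr; exact norm_imExp_sub_le a b x
    _ = (|x| * ‖f x‖) * |a - b| := by ring
    _ ≤ K * |a - b| := by gcongr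

/-! ### Fourier inversion for multipliers. -/

theorem fourierInv_eq_integral_imExp (G : 𝓢(ℝ, ℂ)) (x : ℝ) :
    (𝓕⁻ G) x = ∫ a, G a * imExp (2 * π * a) x := by
  rw [SchwartzMap.fourierInv_coe, Real.fourierInv_eq']
  refine integral_congr_ae (ae_of_all _ fun a => ?_)
  simp only [imExp, smul_eq_mul, RCLike.inner_apply, conj_trivial]
  rw [mul_comm]; push_cast; ring_nf

theorem hasDerivAt_fourierInv (G : 𝓢(ℝ, ℂ)) (x : ℝ) :
    HasDerivAt (𝓕⁻ G : 𝓢(ℝ, ℂ))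
      ((𝓕⁻ ((2 * π * Complex.I) • coordCLM G) : 𝓢(ℝ, ℂ)) x) x := by
  have h := SchwartzMap.lineDerivOp_fourierInv_eq G (1 : ℝ)
  have h2 : SchwartzMap.smulLeftCLM ℂ (fun y : ℝ => inner ℝ y (1 : ℝ)) G = coordCLM G := by
    ext y
    have : (fun y : ℝ => inner ℝ y (1 : ℝ)).HasTemperateGrowth := by fun_prop
    rw [SchwartzMap.smulLeftCLM_apply_apply this, coordCLM_apply]
    simp
  rw [h2] at h
  rw [← h, SchwartzMap.lineDerivOp_apply_eq_fderiv, fderiv_apply_one_eq_deriv]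
  exact SchwartzMap.hasDerivAt _ x

/-- Fourier inversion for the product `(𝓕⁻ G) * f`, valid for the jets. -/
theorem jet_fourierInv_smul (k m : ℕ) (G f : 𝓢(ℝ, ℂ)) :
    Integrable (fun a : ℝ => G a • jet k m (SchwartzMap.smulLeftCLM ℂ (imExp (2 * π * a)) f)) ∧
    ∫ a : ℝ, G a • jet k m (SchwartzMap.smulLeftCLM ℂ (imExp (2 * π * a)) f) =
      jet k m (SchwartzMap.smulLeftCLM ℂ (𝓕⁻ G : 𝓢(ℝ, ℂ)) f) := by
  have hG : ∀ G : 𝓢(ℝ, ℂ), (G : ℝ → ℂ).HasTemperateGrowth := fun G => G.hasTemperateGrowth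
  revert G f
  refine jet_induction (P := fun L => ∀ G f : 𝓢(ℝ, ℂ),
    Integrable (fun a : ℝ => G a • L (SchwartzMap.smulLeftCLM ℂ (imExp (2 * π * a)) f)) ∧
    ∫ a : ℝ, G a • L (SchwartzMap.smulLeftCLM ℂ (imExp (2 * π * a)) f) =
      L (SchwartzMap.smulLeftCLM ℂ (𝓕⁻ G : 𝓢(ℝ, ℂ)) f)) ?_ ?_ ?_ k m
  · intro G f
    have hint : Integrable (fun a : ℝ => G a • SchwartzMap.toBoundedContinuousFunctionCLM ℂ ℝ ℂ
        (SchwartzMap.smulLeftCLM ℂ (imExp (2 * π * a)) f)) := by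
      have hc := (continuous_toBoundedContinuousFunction_imExp f).comp
        (continuous_const.mul continuous_id : Continuous fun a : ℝ => 2 * π * a)
      refine (G.integrable.norm.mul_const (SchwartzMap.seminorm ℂ 0 0 f)).mono'
        (G.continuous.smul hc).aestronglyMeasurable (ae_of_all _ fun a => ?_)
      rw [norm_smul]
      gcongr
      rw [BoundedContinuousFunction.norm_le (apply_nonneg _ _)]
      intro x
      simpa [SchwartzMap.smulLeftCLM_apply_apply (hasTemperateGrowth_imExp _), norm_imExp]
        using SchwartzMap.norm_le_seminorm ℂ f x
    refine ⟨hint, ?_⟩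
    ext x
    have h := (BoundedContinuousFunction.evalCLM ℂ x).integral_comp_comm hint
    simp only [BoundedContinuousFunction.evalCLM_apply] at h
    rw [← h]
    simp only [BoundedContinuousFunction.smul_apply, smul_eq_mul,
      SchwartzMap.toBoundedContinuousFunctionCLM_apply,
      SchwartzMap.smulLeftCLM_apply_apply (hasTemperateGrowth_imExp _),
      SchwartzMap.smulLeftCLM_apply_apply (hG _), ← mul_assoc]
    rw [integral_mul_const, fourierInv_eq_integral_imExp]
  · intro L hL G f
    simpa only [ContinuousLinearMap.comp_apply, coordCLM_smulLeftCLM (hasTemperateGrowth_imExp _),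
      coordCLM_smulLeftCLM (hG _)] using hL G (coordCLM f)
  · intro L hL G f
    -- The factor 2πia from differentiating the exponential is moved onto `G`; the induction
    -- hypothesis covers all `G`, hence also `G₁`.
    set G₁ : 𝓢(ℝ, ℂ) := (2 * π * Complex.I) • coordCLM G with hG₁
    have h1 := derivCLM_smulLeftCLM (hG (𝓕⁻ G)) (hG (𝓕⁻ G₁)) (hasDerivAt_fourierInv G) f
    have h2 : ∀ a : ℝ, G a • L (SchwartzMap.derivCLM ℂ ℂ
        (SchwartzMap.smulLeftCLM ℂ (imExp (2 * π * a)) f)) =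
        G₁ a • L (SchwartzMap.smulLeftCLM ℂ (imExp (2 * π * a)) f) +
        G a • L (SchwartzMap.smulLeftCLM ℂ (imExp (2 * π * a)) (SchwartzMap.derivCLM ℂ ℂ f)) := by
      intro a
      have hsm : SchwartzMap.smulLeftCLM ℂ
          (fun x => Complex.I * ((2 * π * a : ℝ) : ℂ) * imExp (2 * π * a) x) f =
          (Complex.I * ((2 * π * a : ℝ) : ℂ)) • SchwartzMap.smulLeftCLM ℂ (imExp (2 * π * a)) f := by
        ext x
        rw [SchwartzMap.smulLeftCLM_apply_apply (by fun_prop)]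
        simp [SchwartzMap.smulLeftCLM_apply_apply (hasTemperateGrowth_imExp _), mul_assoc]
      rw [derivCLM_smulLeftCLM (g' := fun x => Complex.I * ((2 * π * a : ℝ) : ℂ) *
        imExp (2 * π * a) x) (by fun_prop) (by fun_prop) (hasDerivAt_imExp _) f, hsm, map_add,
        map_smul, smul_add, smul_smul]
      congr 2
      simp [hG₁, coordCLM_apply]; ring
    simp only [ContinuousLinearMap.comp_apply, h2, h1, map_add]
    obtain ⟨i1, e1⟩ := hL G₁ f
    obtain ⟨i2, e2⟩ := hL G (SchwartzMap.derivCLM ℂ ℂ f)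
    exact ⟨i1.add i2, by rw [integral_add i1 i2, e1, e2]⟩

/-- A tempered functional annihilating all `exp (i a x) * f` annihilates all `g * f`. -/
theorem map_smulLeftCLM_eq_zero (T : 𝓢(ℝ, ℂ) →L[ℂ] ℂ) (f : 𝓢(ℝ, ℂ))
    (h : ∀ a : ℝ, T (SchwartzMap.smulLeftCLM ℂ (imExp a) f) = 0) (g : 𝓢(ℝ, ℂ)) :
    T (SchwartzMap.smulLeftCLM ℂ g f) = 0 := by
  obtain ⟨s, L, hL⟩ := exists_eq_comp_jet T
  set G : 𝓢(ℝ, ℂ) := 𝓕 g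
  have hg : g = 𝓕⁻ G := by simp [G]
  have hi : ∀ i : s, Integrable (fun a : ℝ =>
      (G a • fun i : s => jet i.1.1 i.1.2 (SchwartzMap.smulLeftCLM ℂ (imExp (2 * π * a)) f)) i) :=
    fun i => (jet_fourierInv_smul i.1.1 i.1.2 G f).1
  have hint := Integrable.of_eval hi
  rw [hg, hL]
  have : (fun i : s => jet i.1.1 i.1.2 (SchwartzMap.smulLeftCLM ℂ (𝓕⁻ G : 𝓢(ℝ, ℂ)) f)) =
      ∫ a : ℝ, G a • fun i : s =>
        jet i.1.1 i.1.2 (SchwartzMap.smulLeftCLM ℂ (imExp (2 * π * a)) f) := by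
    ext1 i
    rw [eval_integral hi]
    exact (jet_fourierInv_smul i.1.1 i.1.2 G f).2.symm
  rw [this, ← L.integral_comp_comm hint]
  simp [← hL, h]

/-! ### Cutoffs and division by φ. -/

/-- Dilated cutoffs `χ (s x)` converge to `χ 0` as `s → 0`, as multipliers. -/
theorem tendsto_jet_dilation (k m : ℕ) (χ f : 𝓢(ℝ, ℂ)) :
    Tendsto (fun s : ℝ => jet k m (SchwartzMap.smulLeftCLM ℂ (fun x => χ (s * x)) f)) (𝓝 0)
      (𝓝 (jet k m (χ 0 • f))) := by
  have hT : ∀ (χ : 𝓢(ℝ, ℂ)) (s : ℝ), (fun x => χ (s * x)).HasTemperateGrowth := fun χ s =>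
    χ.hasTemperateGrowth.comp (f := fun x : ℝ => s * x) (by fun_prop)
  revert χ f
  refine jet_induction (P := fun L => ∀ χ f : 𝓢(ℝ, ℂ),
    Tendsto (fun s : ℝ => L (SchwartzMap.smulLeftCLM ℂ (fun x => χ (s * x)) f)) (𝓝 0)
      (𝓝 (L (χ 0 • f)))) ?_ ?_ ?_ k m
  · intro χ f
    rw [tendsto_iff_norm_sub_tendsto_zero]
    set C := SchwartzMap.seminorm ℂ 0 1 χ
    have hC : 0 ≤ C := apply_nonneg _ _
    set K := SchwartzMap.seminorm ℂ 1 0 f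
    have hK : 0 ≤ K := apply_nonneg _ _
    have hlim : Tendsto (fun s : ℝ => C * K * |s|) (𝓝 0) (𝓝 0) := by
      have : Continuous fun s : ℝ => C * K * |s| := by fun_prop
      simpa using this.tendsto 0
    refine squeeze_zero (fun _ => norm_nonneg _) (fun s => ?_) hlim
    rw [← map_sub, BoundedContinuousFunction.norm_le (by positivity)]
    intro x
    have h1 := SchwartzMap.norm_pow_mul_le_seminorm ℂ f 1 x
    rw [pow_one, Real.norm_eq_abs] at h1
    have h2 : ‖χ (s * x) - χ 0‖ ≤ C * |s * x| := by
      have := Convex.norm_image_sub_le_of_norm_deriv_le (𝕜 := ℝ) (f := χ) (C := C) (s := Set.univ)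
        (x := 0) (y := s * x) (fun y _ => χ.differentiableAt) (fun y _ => by
          have := SchwartzMap.le_seminorm' ℂ 0 1 χ y
          simpa using this) convex_univ trivial trivial
      simpa using this
    simp only [SchwartzMap.toBoundedContinuousFunctionCLM_apply, _root_.sub_apply,
      _root_.smul_apply, SchwartzMap.smulLeftCLM_apply_apply (hT _ _), ← sub_smul, norm_smul]
    calc _ ≤ C * |s * x| * ‖f x‖ := by gcongr
      _ = C * |s| * (|x| * ‖f x‖) := by rw [abs_mul]; ring
      _ ≤ C * |s| * K := by gcongr
      _ = _ := by ring
  · intro L hL χ f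
    simpa only [ContinuousLinearMap.comp_apply, coordCLM_smulLeftCLM (hT _ _), map_smul]
      using hL χ (coordCLM f)
  · intro L hL χ f
    have h1 : ∀ s : ℝ, SchwartzMap.derivCLM ℂ ℂ (SchwartzMap.smulLeftCLM ℂ (fun x => χ (s * x)) f) =
        (s : ℂ) • SchwartzMap.smulLeftCLM ℂ
          (fun x => SchwartzMap.derivCLM ℂ ℂ χ (s * x)) f +
        SchwartzMap.smulLeftCLM ℂ (fun x => χ (s * x)) (SchwartzMap.derivCLM ℂ ℂ f) := by
      intro s
      have hd := hT (SchwartzMap.derivCLM ℂ ℂ χ) s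
      rw [derivCLM_smulLeftCLM (g' := (s : ℂ) • fun x => SchwartzMap.derivCLM ℂ ℂ χ (s * x))
        (hT χ s) ((Function.HasTemperateGrowth.const (s : ℂ)).smul hd) (fun x => ?_) f,
        SchwartzMap.smulLeftCLM_smul hd]
      · rfl
      · have := (χ.hasDerivAt (s * x)).scomp x ((hasDerivAt_id x).const_mul s)
        simpa [Function.comp_def] using this
    simp only [ContinuousLinearMap.comp_apply, h1, map_add]
    -- Differentiating the cutoff produces a factor s, which kills that term in the limit.
    have h3 : Tendsto (fun s : ℝ => (s : ℂ)) (𝓝 0) (𝓝 0) :=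
      Complex.continuous_ofReal.tendsto' 0 0 (by simp)
    have := (h3.smul (hL (SchwartzMap.derivCLM ℂ ℂ χ) f)).add (hL χ (SchwartzMap.derivCLM ℂ ℂ f))
    simpa only [map_smul, zero_smul, zero_add] using this

/-- If `T` annihilates the Schwartz multiples of a nowhere vanishing `φ`, then `T = 0`. -/
theorem map_eq_zero_of_map_smulLeftCLM (T : 𝓢(ℝ, ℂ) →L[ℂ] ℂ) (φ : 𝓢(ℝ, ℂ))
    (hφ : ∀ x, φ x ≠ 0)
    (h : ∀ g : 𝓢(ℝ, ℂ), T (SchwartzMap.smulLeftCLM ℂ g φ) = 0) (f : 𝓢(ℝ, ℂ)) : T f = 0 := by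
  let b : ContDiffBump (0 : ℝ) := default
  have hbs : ContDiff ℝ (⊤ : ℕ∞) (fun x => (b x : ℂ)) :=
    Complex.ofRealCLM.contDiff.comp b.contDiff
  have hbc : HasCompactSupport (fun x => (b x : ℂ)) :=
    b.hasCompactSupport.comp_left (g := Complex.ofReal) Complex.ofReal_zero
  let χ : 𝓢(ℝ, ℂ) := hbc.toSchwartzMap hbs
  have hχ : ∀ x, χ x = (b x : ℂ) := fun x => rfl
  have hχ0 : χ 0 = 1 := by simp [hχ, b.one_of_mem_closedBall (Metric.mem_closedBall_self b.rIn_pos.le)]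
  have h1 := tendsto_of_tendsto_jet (fun k m => tendsto_jet_dilation k m χ f) T
  rw [hχ0, one_smul] at h1
  -- The value s = 0 is excluded because x ↦ χ(sx) has compact support only for s ≠ 0.
  have h2 := h1.mono_left (nhdsWithin_le_nhds (s := {0}ᶜ))
  refine tendsto_nhds_unique (h2.congr' ?_) tendsto_const_nhds
  filter_upwards [self_mem_nhdsWithin] with s hs
  have hsc : HasCompactSupport (fun x => χ (s * x)) :=
    hbc.comp_homeomorph (Homeomorph.mulLeft₀ s hs)
  have hqs : ContDiff ℝ (⊤ : ℕ∞) (fun x => χ (s * x) * (f x / φ x)) :=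
    ((χ.smooth ⊤).comp (contDiff_const.mul contDiff_id)).mul
      (by simp only [div_eq_mul_inv]; exact (f.smooth ⊤).mul ((φ.smooth ⊤).inv hφ))
  let q : 𝓢(ℝ, ℂ) := (hsc.mul_right (f' := fun x => f x / φ x)).toSchwartzMap hqs
  have hT : (fun x => χ (s * x)).HasTemperateGrowth :=
    χ.hasTemperateGrowth.comp (f := fun x : ℝ => s * x) (by fun_prop)
  rw [← h q]
  congr 1
  ext x
  rw [SchwartzMap.smulLeftCLM_apply_apply hT, SchwartzMap.smulLeftCLM_apply_apply
    q.hasTemperateGrowth]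
  have : q x = χ (s * x) * (f x / φ x) := rfl
  rw [this, smul_eq_mul, smul_eq_mul, mul_assoc, div_mul_cancel₀ _ (hφ x)]

/-! ### Exponential decay. -/

/-- All derivatives are `O(exp (-c|x|))`, with arbitrary polynomial weights. -/
def HasExpDecay (c : ℝ) (f : 𝓢(ℝ, ℂ)) : Prop :=
  ∀ k m : ℕ, ∃ C : ℝ, ∀ x : ℝ,
    (1 + |x|) ^ k * Real.exp (c * |x|) * ‖iteratedDeriv m f x‖ ≤ C

theorem HasExpDecay.derivCLM {c : ℝ} {f : 𝓢(ℝ, ℂ)} (hf : HasExpDecay c f) :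
    HasExpDecay c (SchwartzMap.derivCLM ℂ ℂ f) := by
  intro k m
  obtain ⟨C, hC⟩ := hf k (m + 1)
  refine ⟨C, fun x => ?_⟩
  rw [iteratedDeriv_succ'] at hC
  exact hC x

/-- Leibniz rule; the arbitrary polynomial weight in `HasExpDecay` absorbs the growth of `g` with no
loss in `c`. -/
theorem HasExpDecay.smulLeftCLM {c : ℝ} {f : 𝓢(ℝ, ℂ)} (hf : HasExpDecay c f) {g : ℝ → ℂ}
    (hg : g.HasTemperateGrowth) : HasExpDecay c (SchwartzMap.smulLeftCLM ℂ g f) := by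
  intro k m
  obtain ⟨l, C, hC, hgC⟩ := hg.norm_iteratedFDeriv_le_uniform m
  choose K hK using hf
  refine ⟨∑ i ∈ Finset.range (m + 1), m.choose i * C * K (k + l) (m - i), fun x => ?_⟩
  have h1 : (SchwartzMap.smulLeftCLM ℂ g f : ℝ → ℂ) = fun x => g x * f x := by
    ext x; simp [SchwartzMap.smulLeftCLM_apply_apply hg]
  have h2 := norm_iteratedFDeriv_mul_le (N := m) (hg.1.of_le (by exact_mod_cast le_top))
    (f.smooth m) x (n := m) le_rfl
  rw [h1, ← norm_iteratedFDeriv_eq_norm_iteratedDeriv]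
  refine (mul_le_mul_of_nonneg_left h2 (by positivity)).trans ?_
  calc _
    _ = ∑ i ∈ Finset.range (m + 1), (1 + |x|) ^ k * Real.exp (c * |x|) *
      (m.choose i * ‖iteratedFDeriv ℝ i g x‖ * ‖iteratedFDeriv ℝ (m - i) f x‖) := by
        rw [Finset.mul_sum]
    _ ≤ _ := by
      refine Finset.sum_le_sum fun i hi => ?_
      have hi' : i ≤ m := Nat.lt_succ_iff.1 (Finset.mem_range.1 hi)
      have h3 := hgC i hi' x
      have h4 := hK (k + l) (m - i) x
      rw [Real.norm_eq_abs] at h3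
      rw [norm_iteratedFDeriv_eq_norm_iteratedDeriv (n := m - i)]
      calc _ ≤ (1 + |x|) ^ k * Real.exp (c * |x|) *
            (m.choose i * (C * (1 + |x|) ^ l) * ‖iteratedDeriv (m - i) f x‖) := by gcongr
        _ = m.choose i * C *
            ((1 + |x|) ^ (k + l) * Real.exp (c * |x|) * ‖iteratedDeriv (m - i) f x‖) := by
          rw [pow_add]; ring
        _ ≤ _ := by gcongr

theorem HasExpDecay.coordCLM {c : ℝ} {f : 𝓢(ℝ, ℂ)} (hf : HasExpDecay c f) :
    HasExpDecay c (WeakMoment.coordCLM f) :=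
  hf.smulLeftCLM (by fun_prop)

theorem ExpTypeDecay.exists_hasExpDecay {β : ℝ} (hβ : 1 ≤ β) {φ : 𝓢(ℝ, ℂ)}
    (h : ExpTypeDecay β φ) : ∃ c > 0, HasExpDecay c φ := by
  obtain ⟨A, hA, C, hC, h⟩ := h
  -- The series below gives the rate 1/(2A); half of it is spent on the polynomial weight.
  refine ⟨1 / (4 * A), by positivity, fun k m => ?_⟩
  have key : ∀ x : ℝ, Real.exp ((1 + |x|) / (2 * A)) * ‖iteratedDeriv m φ x‖ ≤ 2 * C m := by
    intro x
    set t := 1 + |x| with ht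
    set N := ‖iteratedDeriv m φ x‖
    have hs : HasSum (fun n : ℕ => (t / (2 * A)) ^ n / n.factorial * N)
        (Real.exp (t / (2 * A)) * N) := by
      have := NormedSpace.expSeries_div_hasSum_exp (𝔸 := ℝ) (t / (2 * A))
      rw [← Real.exp_eq_exp_ℝ] at this
      exact this.mul_right N
    have hg : HasSum (fun n : ℕ => (1 / 2 : ℝ) ^ n * C m) (2 * C m) :=
      hasSum_geometric_two.mul_right _
    -- Termwise, (n!)^(1/β) ≤ n! cancels the factorial of the exponential series, leaving 2^(-n) C
    -- m.
    refine hasSum_le (fun n => ?_) hs hg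
    have hf1 : (1 : ℝ) ≤ n.factorial := by exact_mod_cast n.factorial_pos
    have hfact : (n.factorial : ℝ) ^ (1 / β) ≤ n.factorial := by
      conv_rhs => rw [← Real.rpow_one (n.factorial : ℝ)]
      exact Real.rpow_le_rpow_of_exponent_le hf1 (by rw [div_le_one (by linarith)]; exact hβ)
    have h1 : t ^ n * N ≤ C m * A ^ n * n.factorial :=
      (h n m x).trans (mul_le_mul_of_nonneg_left hfact (by have := hC m; positivity))
    calc (t / (2 * A)) ^ n / n.factorial * N
        = (t ^ n * N) / ((2 * A) ^ n * n.factorial) := by rw [div_pow]; field_simp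
      _ ≤ (C m * A ^ n * n.factorial) / ((2 * A) ^ n * n.factorial) := by gcongr
      _ = (1 / 2) ^ n * C m := by rw [mul_pow, div_pow, one_pow]; field_simp
  refine ⟨k.factorial * (4 * A) ^ k * (2 * C m), fun x => ?_⟩
  have hk := Real.pow_div_factorial_le_exp ((1 + |x|) / (4 * A)) (by positivity) k
  have h1 : (1 + |x|) ^ k ≤ k.factorial * (4 * A) ^ k * Real.exp ((1 + |x|) / (4 * A)) := by
    rw [div_pow, div_div, div_le_iff₀ (by positivity)] at hk
    linarith
  have h2 : Real.exp (1 / (4 * A) * |x|) ≤ Real.exp ((1 + |x|) / (4 * A)) := by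
    rw [Real.exp_le_exp, div_mul_eq_mul_div, one_mul]; gcongr; linarith
  have h3 : Real.exp ((1 + |x|) / (4 * A)) * Real.exp ((1 + |x|) / (4 * A)) =
      Real.exp ((1 + |x|) / (2 * A)) := by
    rw [← Real.exp_add]; congr 1; field_simp; norm_num
  calc _ ≤ (k.factorial * (4 * A) ^ k * Real.exp ((1 + |x|) / (4 * A))) *
        Real.exp ((1 + |x|) / (4 * A)) * ‖iteratedDeriv m φ x‖ := by gcongr
    _ = k.factorial * (4 * A) ^ k *
        (Real.exp ((1 + |x|) / (2 * A)) * ‖iteratedDeriv m φ x‖) := by rw [← h3]; ring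
    _ ≤ _ := mul_le_mul_of_nonneg_left (key x) (by positivity)

/-! ### Propagation of vanishing moments in frequency. -/

/-- The Taylor polynomial of `imExp h` with `N` terms. -/
noncomputable def imExpTaylor (h : ℝ) (N : ℕ) (x : ℝ) : ℂ :=
  ∑ n ∈ Finset.range N, (Complex.I * h) ^ n / n.factorial * (x : ℂ) ^ n

@[fun_prop]
theorem hasTemperateGrowth_imExpTaylor (h : ℝ) (N : ℕ) :
    (imExpTaylor h N).HasTemperateGrowth := by
  refine Function.HasTemperateGrowth.sum fun n _ => ?_
  exact (Function.HasTemperateGrowth.const _).mul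
    (Function.HasTemperateGrowth.pow (by fun_prop) n)

theorem hasDerivAt_imExpTaylor_succ (h : ℝ) (N : ℕ) (x : ℝ) :
    HasDerivAt (imExpTaylor h (N + 1)) (Complex.I * h * imExpTaylor h N x) x := by
  have h1 : ∀ n : ℕ, HasDerivAt (fun x : ℝ => (Complex.I * h) ^ n / n.factorial * (x : ℂ) ^ n)
      ((Complex.I * h) ^ n / n.factorial * (n * (x : ℂ) ^ (n - 1))) x := fun n => by
    simpa using ((hasDerivAt_pow n (x : ℂ)).comp_ofReal).const_mul _
  have h2 := HasDerivAt.fun_sum (u := Finset.range (N + 1)) fun n _ => h1 n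
  refine h2.congr_deriv ?_
  rw [Finset.sum_range_succ', imExpTaylor, Finset.mul_sum]
  simp only [Nat.cast_zero, zero_mul, mul_zero, add_zero, Nat.add_sub_cancel]
  refine Finset.sum_congr rfl fun n _ => ?_
  rw [Nat.factorial_succ]
  have : (n.factorial : ℂ) ≠ 0 := by exact_mod_cast n.factorial_ne_zero
  have : (n + 1 : ℂ) ≠ 0 := by exact_mod_cast n.succ_ne_zero
  push_cast
  field_simp
  ring

/-- With r = |h|/c ≤ 1, each tail term is r^(n+N) ≤ r^N times the corresponding term of the series
of exp(c|x|). -/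
theorem norm_imExp_sub_imExpTaylor_le {c h : ℝ} (hc : 0 < c) (hh : |h| < c) (N : ℕ) (x : ℝ) :
    ‖imExp h x - imExpTaylor h N x‖ ≤ (|h| / c) ^ N * Real.exp (c * |x|) := by
  set r := |h| / c
  have hr0 : 0 ≤ r := by positivity
  have hr1 : r ≤ 1 := (div_lt_one hc).2 hh |>.le
  have e1 : ∀ n : ℕ, (Complex.I * h) ^ n / n.factorial * (x : ℂ) ^ n =
      (Complex.I * h * x) ^ n / n.factorial := fun n => by rw [mul_pow _ (x : ℂ)]; ring
  have hs : HasSum (fun n : ℕ => (Complex.I * h * x) ^ n / n.factorial) (imExp h x) := by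
    have := NormedSpace.expSeries_div_hasSum_exp (𝔸 := ℂ) (Complex.I * h * x)
    rwa [← Complex.exp_eq_exp_ℂ] at this
  have ht : HasSum (fun n : ℕ => (c * |x|) ^ n / n.factorial) (Real.exp (c * |x|)) := by
    have := NormedSpace.expSeries_div_hasSum_exp (𝔸 := ℝ) (c * |x|)
    rwa [← Real.exp_eq_exp_ℝ] at this
  have hs' := (hasSum_nat_add_iff' N).2 hs
  have ht' := ((hasSum_nat_add_iff' N).2 ht).mul_left (r ^ N)
  simp only [imExpTaylor, e1]
  rw [← hs'.tsum_eq]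
  refine (tsum_of_norm_bounded ht' fun n => ?_).trans ?_
  · have e2 : |h| = r * c := by simp only [r]; field_simp
    rw [norm_div, norm_pow, norm_mul, norm_mul, Complex.norm_I, one_mul, Complex.norm_real,
      Complex.norm_real, Real.norm_eq_abs, Real.norm_eq_abs, e2, mul_assoc, mul_pow r,
      Complex.norm_natCast, mul_div_assoc]
    gcongr ?_ * _
    exact pow_le_pow_of_le_one hr0 hr1 (Nat.le_add_left N n)
  · gcongr
    have : 0 ≤ ∑ i ∈ Finset.range N, (c * |x|) ^ i / (i.factorial : ℝ) :=
      Finset.sum_nonneg fun i _ => by positivity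
    linarith

/-- On exponentially decaying functions the Taylor series of `imExp h` converges as a series of
multipliers. -/
theorem tendsto_jet_imExpTaylor {c h : ℝ} (hc : 0 < c) (hh : |h| < c) (k m : ℕ) (f : 𝓢(ℝ, ℂ))
    (hf : HasExpDecay c f) :
    Tendsto (fun N => jet k m (SchwartzMap.smulLeftCLM ℂ (imExpTaylor h N) f)) atTop
      (𝓝 (jet k m (SchwartzMap.smulLeftCLM ℂ (imExp h) f))) := by
  have hsm : ∀ {g : ℝ → ℂ} (_ : g.HasTemperateGrowth) (f : 𝓢(ℝ, ℂ)),
      SchwartzMap.smulLeftCLM ℂ (fun x => Complex.I * h * g x) f =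
        (Complex.I * h) • SchwartzMap.smulLeftCLM ℂ g f := fun hg f => by
    have := SchwartzMap.smulLeftCLM_smul (F := ℂ) hg (Complex.I * h)
    exact congrArg (fun L => L f) this
  revert f
  refine jet_induction (P := fun L => ∀ f : 𝓢(ℝ, ℂ), HasExpDecay c f →
    Tendsto (fun N => L (SchwartzMap.smulLeftCLM ℂ (imExpTaylor h N) f)) atTop
      (𝓝 (L (SchwartzMap.smulLeftCLM ℂ (imExp h) f)))) ?_ ?_ ?_ k m
  · intro f hf
    obtain ⟨C, hC⟩ := hf 0 0
    have hC0 : 0 ≤ C := le_trans (by positivity) (hC 0)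
    rw [tendsto_iff_norm_sub_tendsto_zero]
    have hlim : Tendsto (fun N : ℕ => (|h| / c) ^ N * C) atTop (𝓝 0) := by
      simpa using (tendsto_pow_atTop_nhds_zero_of_lt_one (by positivity)
        ((div_lt_one hc).2 hh)).mul_const C
    refine squeeze_zero (fun _ => norm_nonneg _) (fun N => ?_) hlim
    rw [← map_sub, BoundedContinuousFunction.norm_le (by positivity)]
    intro x
    have h1 := hC x
    rw [pow_zero, one_mul, iteratedDeriv_zero] at h1
    simp only [SchwartzMap.toBoundedContinuousFunctionCLM_apply, _root_.sub_apply,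
      SchwartzMap.smulLeftCLM_apply_apply (hasTemperateGrowth_imExp _),
      SchwartzMap.smulLeftCLM_apply_apply (hasTemperateGrowth_imExpTaylor _ _),
      ← sub_smul, norm_smul]
    rw [norm_sub_rev]
    calc _ ≤ (|h| / c) ^ N * Real.exp (c * |x|) * ‖f x‖ := by
          gcongr; exact norm_imExp_sub_imExpTaylor_le hc hh N x
      _ = (|h| / c) ^ N * (Real.exp (c * |x|) * ‖f x‖) := by ring
      _ ≤ _ := by gcongr
  · intro L hL f hf
    simpa only [ContinuousLinearMap.comp_apply, coordCLM_smulLeftCLM (hasTemperateGrowth_imExp _),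
      coordCLM_smulLeftCLM (hasTemperateGrowth_imExpTaylor _ _)] using hL _ hf.coordCLM
  · intro L hL f hf
    -- Differentiation lowers the number of Taylor terms by one, hence the index shift.
    rw [← tendsto_add_atTop_iff_nat 1]
    have h1 : ∀ N, SchwartzMap.derivCLM ℂ ℂ
        (SchwartzMap.smulLeftCLM ℂ (imExpTaylor h (N + 1)) f) =
        (Complex.I * h) • SchwartzMap.smulLeftCLM ℂ (imExpTaylor h N) f +
        SchwartzMap.smulLeftCLM ℂ (imExpTaylor h (N + 1)) (SchwartzMap.derivCLM ℂ ℂ f) := fun N => by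
      rw [derivCLM_smulLeftCLM (by fun_prop) (by fun_prop) (hasDerivAt_imExpTaylor_succ h N),
        hsm (by fun_prop)]
    simp only [ContinuousLinearMap.comp_apply, h1, map_add, map_smul]
    rw [derivCLM_smulLeftCLM (by fun_prop) (by fun_prop) (hasDerivAt_imExp h),
      hsm (by fun_prop), map_add, map_smul]
    exact ((hL f hf).const_smul _).add
      ((hL _ hf.derivCLM).comp (tendsto_add_atTop_nat 1))

/-- Vanishing moments propagate from the frequency `ξ` to nearby frequencies. -/
theorem map_imExp_add_eq_zero {c h ξ : ℝ} (hc : 0 < c) (hh : |h| < c) {φ : 𝓢(ℝ, ℂ)}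
    (hφ : HasExpDecay c φ) (T : 𝓢(ℝ, ℂ) →L[ℂ] ℂ)
    (hT : ∀ n : ℕ, T (SchwartzMap.smulLeftCLM ℂ (imExp ξ) (monomialMul n φ)) = 0) (n : ℕ) :
    T (SchwartzMap.smulLeftCLM ℂ (imExp (ξ + h)) (monomialMul n φ)) = 0 := by
  set f := SchwartzMap.smulLeftCLM ℂ (imExp ξ) (monomialMul n φ) with hf
  have hfd : HasExpDecay c f := by
    refine HasExpDecay.smulLeftCLM (HasExpDecay.smulLeftCLM hφ ?_) (by fun_prop)
    exact Function.HasTemperateGrowth.pow (by fun_prop) n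
  have h1 := tendsto_of_tendsto_jet (fun k m => tendsto_jet_imExpTaylor hc hh k m f hfd) T
  have h2 : SchwartzMap.smulLeftCLM ℂ (imExp h) f =
      SchwartzMap.smulLeftCLM ℂ (imExp (ξ + h)) (monomialMul n φ) := by
    ext x
    simp only [hf, SchwartzMap.smulLeftCLM_apply_apply (hasTemperateGrowth_imExp _), imExp_add,
      smul_eq_mul]
    ring
  rw [h2] at h1
  refine tendsto_nhds_unique h1 (tendsto_const_nhds.congr fun N => ?_)
  -- A Taylor polynomial times `f` is a combination of the functions that `T` annihilates at
  -- frequency ξ.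
  have h3 : SchwartzMap.smulLeftCLM ℂ (imExpTaylor h N) f =
      ∑ j ∈ Finset.range N, ((Complex.I * h) ^ j / j.factorial) •
        SchwartzMap.smulLeftCLM ℂ (imExp ξ) (monomialMul (n + j) φ) := by
    ext x
    rw [_root_.sum_apply]
    simp only [_root_.smul_apply, hf,
      SchwartzMap.smulLeftCLM_apply_apply (hasTemperateGrowth_imExp _),
      SchwartzMap.smulLeftCLM_apply_apply (hasTemperateGrowth_imExpTaylor _ _),
      monomialMul_apply, imExpTaylor, smul_eq_mul, Finset.sum_mul]
    refine Finset.sum_congr rfl fun j _ => ?_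
    rw [pow_add]; ring
  simp [h3, hT]

theorem map_imExp_eq_zero {c : ℝ} (hc : 0 < c) {φ : 𝓢(ℝ, ℂ)} (hφ : HasExpDecay c φ)
    (T : 𝓢(ℝ, ℂ) →L[ℂ] ℂ) (hT : ∀ n : ℕ, T (monomialMul n φ) = 0) (ξ : ℝ) :
    T (SchwartzMap.smulLeftCLM ℂ (imExp ξ) φ) = 0 := by
  obtain ⟨N, hN⟩ := exists_nat_gt (|ξ| / c)
  have hN0 : (0 : ℝ) < N := lt_of_le_of_lt (by positivity) hN
  have hstep : |ξ / N| < c := by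
    rw [abs_div, Nat.abs_cast, div_lt_iff₀ hN0, mul_comm]
    exact (div_lt_iff₀ hc).1 hN
  -- The induction carries all orders `n`, since one step uses every moment at the previous
  -- frequency.
  have h : ∀ j n : ℕ,
      T (SchwartzMap.smulLeftCLM ℂ (imExp (j * (ξ / N))) (monomialMul n φ)) = 0 := by
    intro j
    induction j with
    | zero =>
      intro n
      rw [← hT n]
      congr 1
      ext x
      rw [SchwartzMap.smulLeftCLM_apply_apply (hasTemperateGrowth_imExp _)]
      simp [imExp]
    | succ j ih =>
      intro n
      have := map_imExp_add_eq_zero hc hstep hφ T ih n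
      rwa [show (j : ℝ) * (ξ / N) + ξ / N = ((j + 1 : ℕ) : ℝ) * (ξ / N) by push_cast; ring] at this
  have h1 := h N 0
  rw [mul_div_cancel₀ _ hN0.ne'] at h1
  have h2 : monomialMul 0 φ = φ := by ext x; simp [monomialMul_apply]
  rwa [h2] at h1

end WeakMoment

open WeakMoment in
theorem mainTheorem1 (β : ℝ) (hβ : 1 ≤ β) (φ : 𝓢(ℝ, ℂ))
    (hpos : ∀ x : ℝ, ∃ r : ℝ, 0 < r ∧ φ x = (r : ℂ))
    (hdecay : WeakMoment.ExpTypeDecay β φ)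
    (T₁ T₂ : 𝓢'(ℝ, ℂ))
    (hmom : ∀ n : ℕ, WeakMoment.weakMoment T₁ φ n = WeakMoment.weakMoment T₂ φ n) :
    T₁ = T₂ := by
  obtain ⟨c, hc, hφ⟩ := hdecay.exists_hasExpDecay hβ
  let T : 𝓢(ℝ, ℂ) →L[ℂ] ℂ :=
    ⟨T₁.toLinearMap - T₂.toLinearMap, T₁.continuous.sub T₂.continuous⟩
  have hT : ∀ f, T f = T₁ f - T₂ f := fun f => rfl
  have hne : ∀ x, φ x ≠ 0 := fun x => by
    obtain ⟨r, hr, h⟩ := hpos x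
    rw [h]; exact_mod_cast hr.ne'
  have h0 : ∀ n, T (monomialMul n φ) = 0 := fun n => by
    rw [hT, sub_eq_zero]; exact hmom n
  ext f
  have := map_eq_zero_of_map_smulLeftCLM T φ hne
    (map_smulLeftCLM_eq_zero T φ (map_imExp_eq_zero hc hφ T h0)) f
  rwa [hT, sub_eq_zero] at this
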